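/- For $g\in L^2(\mathbb R)$ and $\Lambda\subseteq\mathbb R^2$ let $$\mathbf G(g,\Lambda)=\{\,e^{2\pi i s x}g(x-t) : (t,s)\in\Lambda\,\}\subseteq L^2(\mathbb R)$$ be the Gabor system of $g$ along $\Lambda$. Let $R_\theta=\begin{pmatrix}\cos\theta&-\sin\theta\\ \sin\theta&\cos\theta\end{pmatrix}$, and for $n\ge 0$ let $h_n(x)=\frac{2^{1/4}}{\sqrt{n!}}\,\mathrm{He}_n(2\sqrt{\pi}\,x)\,e^{-\pi x^2}$ be the normalized Hermite functions, where $\mathrm{He}_n$ is the $n$-th probabilists' Hermite polynomial. For $\theta\in\mathbb R$ the fractional Fourier transform of angle $\theta$ is the operator on $L^2(\mathbb R)$ given by $$\mathcal F_\theta f=\sum_{n=0}^\infty e^{-in\theta}\langle f,h_n\rangle h_n ,$$ with convergence in $L^2(\mathbb R)$. **Theorem 1.3.** Let $\theta\in\mathbb R$ with $\theta\notin\frac{\pi}{2}\mathbb Z$, let $\Lambda=R_\theta\mathbb Z^2$, and let $g=\mathcal F_{-\theta}\mathbf 1_{[0,1]}$. Then $\mathbf G(g,\Lambda)$ is an orthonormal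 basis of $L^2(\mathbb R)$, but $\mathbf G(g,A\times B)$ is not an orthonormal basis of $L^2(\mathbb R)$ for any sets $A,B\subseteq\mathbb R$. In particular, there exists $g\in L^2(\mathbb R)$ with these two properties. -/

import Mathlib

open MeasureTheory
open scoped ENNReal

/-- The Hilbert space `L²(ℝ)` of (classes of) complex-valued square-integrable functions. -/
abbrev L2R : Type := Lp ℂ 2 (volume : Measure ℝ)

/-- A set of vectors of `L²(ℝ)` is an orthonormal basis if it is orthonormal and its
linear span is dense. -/
def IsOrthonormalBasis (S : Set L2R) : Prop :=
  Orthonormal ℂ (Subtype.val : S → L2R) ∧ (Submodule.span ℂ S).topologicalClosure = ⊤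

theorem memLp_timeFrequencyShift (g : L2R) (t s : ℝ) :
    MemLp (fun x : ℝ => Complex.exp (2 * Real.pi * Complex.I * s * x) * g (x - t)) 2 volume := by
  have h1 : MemLp (fun x : ℝ => g (x - t)) 2 volume :=
    (Lp.memLp g).comp_measurePreserving (measurePreserving_sub_right volume t)
  have hc : Continuous (fun x : ℝ => Complex.exp (2 * Real.pi * Complex.I * s * x)) := by
    fun_prop
  refine h1.of_le (hc.aestronglyMeasurable.mul h1.1) (Filter.Eventually.of_forall fun x => ?_)
  have h2 : (2 * Real.pi * Complex.I * s * x : ℂ) = ((2 * Real.pi * s * x : ℝ) : ℂ) * Complex.I := by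
    push_cast; ring
  rw [norm_mul, h2, Complex.norm_exp_ofReal_mul_I, one_mul]

/-- The time-frequency shift `x ↦ e^{2πisx} g(x - t)` of `g ∈ L²(ℝ)`. -/
noncomputable def timeFrequencyShift (g : L2R) (t s : ℝ) : L2R :=
  (memLp_timeFrequencyShift g t s).toLp
    (fun x : ℝ => Complex.exp (2 * Real.pi * Complex.I * s * x) * g (x - t))

/-- The Gabor system `G(g, Λ) = {e^{2πisx} g(x - t) : (t, s) ∈ Λ} ⊆ L²(ℝ)`. -/
def gaborSystem (g : L2R) (Λ : Set (ℝ × ℝ)) : Set L2R :=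
  (fun p : ℝ × ℝ => timeFrequencyShift g p.1 p.2) '' Λ

/-- The integer lattice `ℤ²` in the plane. -/
def integerLattice : Set (ℝ × ℝ) :=
  Set.range fun z : ℤ × ℤ => ((z.1 : ℝ), (z.2 : ℝ))

/-- The rotation of the plane with matrix `(cos θ, -sin θ; sin θ, cos θ)`. -/
noncomputable def planeRotation (θ : ℝ) (p : ℝ × ℝ) : ℝ × ℝ :=
  (Real.cos θ * p.1 - Real.sin θ * p.2, Real.sin θ * p.1 + Real.cos θ * p.2)

/-- The `n`-th normalized Hermite function
`2^{1/4} (n!)^{-1/2} He_n(2√π x) e^{-πx²}`, with `He_n` the probabilists' Hermite polynomial.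
This is the normalization that belongs to the Fourier transform with kernel `e^{-2πixξ}`. -/
noncomputable def hermiteFunction (n : ℕ) (x : ℝ) : ℝ :=
  (2 : ℝ) ^ (1 / 4 : ℝ) / Real.sqrt (n.factorial : ℝ)
    * Polynomial.aeval (2 * Real.sqrt Real.pi * x) (Polynomial.hermite n)
    * Real.exp (-Real.pi * x ^ 2)

theorem integrable_poly_mul_gaussian (p : Polynomial ℝ) {b : ℝ} (hb : 0 < b) :
    Integrable (fun x : ℝ => p.eval x * Real.exp (-b * x ^ 2)) volume := by
  induction p using Polynomial.induction_on' with
  | add p q hp hq =>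
    simp only [Polynomial.eval_add, add_mul]
    exact Integrable.add hp hq
  | monomial n a =>
    have h := (integrable_rpow_mul_exp_neg_mul_sq hb (s := (n : ℝ))
      (by have : (0 : ℝ) ≤ n := n.cast_nonneg
          linarith)).const_mul a
    simpa [Polynomial.eval_monomial, Real.rpow_natCast, mul_assoc] using h

theorem integral_poly_mul_hermite_succ (p : Polynomial ℝ) (n : ℕ) :
    ∫ x : ℝ, (p * (Polynomial.hermite (n + 1)).map (Int.castRingHom ℝ)).eval x
        * Real.exp (-(1 / 2) * x ^ 2) =
      ∫ x : ℝ, (p.derivative * (Polynomial.hermite n).map (Int.castRingHom ℝ)).eval x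
        * Real.exp (-(1 / 2) * x ^ 2) := by
  set H : Polynomial ℝ := (Polynomial.hermite n).map (Int.castRingHom ℝ) with hH
  have hS : (Polynomial.hermite (n + 1)).map (Int.castRingHom ℝ)
      = Polynomial.X * H - H.derivative := by
    simp [Polynomial.hermite_succ, hH, Polynomial.derivative_map]
  have hb : (0 : ℝ) < 1 / 2 := by norm_num
  have hd : ∀ x : ℝ, HasDerivAt (fun x : ℝ => (p * H).eval x * Real.exp (-(1 / 2) * x ^ 2))
      ((p.derivative * H).eval x * Real.exp (-(1 / 2) * x ^ 2)
        - (p * (Polynomial.X * H - H.derivative)).eval x * Real.exp (-(1 / 2) * x ^ 2)) x := by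
    intro x
    have h1 := (p * H).hasDerivAt x
    have h2 : HasDerivAt (fun x : ℝ => Real.exp (-(1 / 2) * x ^ 2))
        (Real.exp (-(1 / 2) * x ^ 2) * (-(1 / 2) * (2 * x))) x := by
      simpa using ((hasDerivAt_pow 2 x).const_mul (-(1 / 2) : ℝ)).exp
    refine (h1.fun_mul h2).congr_deriv ?_
    simp only [Polynomial.derivative_mul, Polynomial.eval_mul, Polynomial.eval_add,
      Polynomial.eval_sub, Polynomial.eval_X]
    ring
  have i1 := integrable_poly_mul_gaussian (p.derivative * H) hb
  have i2 := integrable_poly_mul_gaussian (p * (Polynomial.X * H - H.derivative)) hb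
  have h0 := integral_eq_zero_of_hasDerivAt_of_integrable hd (i1.sub i2)
    (integrable_poly_mul_gaussian (p * H) hb)
  rw [integral_sub i1 i2] at h0
  rw [hS]
  linarith

theorem integral_poly_mul_hermite (p : Polynomial ℝ) (n : ℕ) :
    ∫ x : ℝ, (p * (Polynomial.hermite n).map (Int.castRingHom ℝ)).eval x
        * Real.exp (-(1 / 2) * x ^ 2) =
      ∫ x : ℝ, (Polynomial.derivative^[n] p).eval x * Real.exp (-(1 / 2) * x ^ 2) := by
  induction n generalizing p with
  | zero => simp
  | succ n ih => rw [integral_poly_mul_hermite_succ, ih, Function.iterate_succ_apply]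

theorem integral_hermite_mul_hermite_of_le {m n : ℕ} (hmn : m ≤ n) :
    ∫ x : ℝ, ((Polynomial.hermite m).map (Int.castRingHom ℝ)
        * (Polynomial.hermite n).map (Int.castRingHom ℝ)).eval x
        * Real.exp (-(1 / 2) * x ^ 2) =
      if m = n then n.factorial * Real.sqrt (2 * Real.pi) else 0 := by
  rw [integral_poly_mul_hermite]
  have hdeg : ((Polynomial.hermite m).map (Int.castRingHom ℝ)).natDegree = m := by
    rw [(Polynomial.hermite_monic m).natDegree_map, Polynomial.natDegree_hermite]
  split_ifs with h
  · subst h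
    have h1 : Polynomial.derivative^[m] ((Polynomial.hermite m).map (Int.castRingHom ℝ))
        = Polynomial.C (m.factorial : ℝ) := by
      have hd0 := Polynomial.natDegree_iterate_derivative
        ((Polynomial.hermite m).map (Int.castRingHom ℝ)) m
      rw [hdeg, Nat.sub_self] at hd0
      rw [Polynomial.eq_C_of_natDegree_le_zero hd0, Polynomial.coeff_iterate_derivative]
      simp [Polynomial.coeff_hermite_self, Nat.descFactorial_self]
    rw [h1]
    simp only [Polynomial.eval_C]
    rw [integral_const_mul, integral_gaussian]
    congr 2
    ring
  · rw [Polynomial.iterate_derivative_eq_zero (by rw [hdeg]; omega)]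
    simp

theorem integral_hermite_mul_hermite (m n : ℕ) :
    ∫ x : ℝ, ((Polynomial.hermite m).map (Int.castRingHom ℝ)
        * (Polynomial.hermite n).map (Int.castRingHom ℝ)).eval x
        * Real.exp (-(1 / 2) * x ^ 2) =
      if m = n then n.factorial * Real.sqrt (2 * Real.pi) else 0 := by
  rcases le_total m n with h | h
  · exact integral_hermite_mul_hermite_of_le h
  · rw [mul_comm, integral_hermite_mul_hermite_of_le h]
    by_cases hmn : m = n
    · subst hmn; simp
    · rw [if_neg hmn, if_neg (Ne.symm hmn)]

theorem hermiteFunction_mul (m n : ℕ) (x : ℝ) :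
    hermiteFunction m x * hermiteFunction n x =
      Real.sqrt 2 / (Real.sqrt (m.factorial : ℝ) * Real.sqrt (n.factorial : ℝ)) *
      (((Polynomial.hermite m).map (Int.castRingHom ℝ)
        * (Polynomial.hermite n).map (Int.castRingHom ℝ)).eval (2 * Real.sqrt Real.pi * x)
        * Real.exp (-(1 / 2) * (2 * Real.sqrt Real.pi * x) ^ 2)) := by
  have h2 : (2 : ℝ) ^ (1 / 4 : ℝ) * (2 : ℝ) ^ (1 / 4 : ℝ) = Real.sqrt 2 := by
    rw [← Real.rpow_add (by norm_num), Real.sqrt_eq_rpow]; norm_num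
  have he : Real.exp (-(1 / 2) * (2 * Real.sqrt Real.pi * x) ^ 2)
      = Real.exp (-Real.pi * x ^ 2) * Real.exp (-Real.pi * x ^ 2) := by
    rw [← Real.exp_add]
    congr 1
    have := Real.sq_sqrt Real.pi_pos.le
    linear_combination (-2 * x ^ 2) * this
  have ha : ∀ k : ℕ, Polynomial.aeval (2 * Real.sqrt Real.pi * x) (Polynomial.hermite k)
      = ((Polynomial.hermite k).map (Int.castRingHom ℝ)).eval (2 * Real.sqrt Real.pi * x) := by
    intro k
    rw [Polynomial.eval_map, Polynomial.aeval_def]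
    rfl
  unfold hermiteFunction
  rw [he, ← h2, ha, ha, Polynomial.eval_mul]
  ring

theorem integrable_hermiteFunction_mul (m n : ℕ) :
    Integrable (fun x : ℝ => hermiteFunction m x * hermiteFunction n x) volume := by
  simp_rw [hermiteFunction_mul]
  have hc : 2 * Real.sqrt Real.pi ≠ 0 := by positivity
  exact ((integrable_poly_mul_gaussian _ (by norm_num : (0 : ℝ) < 1 / 2)).comp_mul_left'
    hc).const_mul _

theorem integral_hermiteFunction_mul (m n : ℕ) :
    ∫ x : ℝ, hermiteFunction m x * hermiteFunction n x = if m = n then 1 else 0 := by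
  simp_rw [hermiteFunction_mul]
  rw [integral_const_mul, Measure.integral_comp_mul_left
    (fun y : ℝ => ((Polynomial.hermite m).map (Int.castRingHom ℝ)
        * (Polynomial.hermite n).map (Int.castRingHom ℝ)).eval y
        * Real.exp (-(1 / 2) * y ^ 2)), integral_hermite_mul_hermite]
  split_ifs with h
  · subst h
    have hf : (0 : ℝ) < m.factorial := by exact_mod_cast m.factorial_pos
    have hpi : 0 < Real.sqrt Real.pi := Real.sqrt_pos.2 Real.pi_pos
    rw [Real.mul_self_sqrt hf.le, abs_of_pos (by positivity), Real.sqrt_mul (by norm_num),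
      smul_eq_mul]
    have := Real.mul_self_sqrt (show (0 : ℝ) ≤ 2 by norm_num)
    field_simp
    linarith
  · simp

theorem memLp_hermiteFunction (n : ℕ) :
    MemLp (fun x : ℝ => (hermiteFunction n x : ℂ)) 2 volume := by
  have hc : Continuous (hermiteFunction n) := by
    unfold hermiteFunction
    have : Continuous fun x : ℝ =>
        Polynomial.aeval (2 * Real.sqrt Real.pi * x) (Polynomial.hermite n) :=
      (Polynomial.continuous_aeval _).comp (by fun_prop)
    fun_prop
  have h : MemLp (hermiteFunction n) 2 volume := by
    rw [memLp_two_iff_integrable_sq hc.aestronglyMeasurable]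
    simpa [sq] using integrable_hermiteFunction_mul n n
  exact h.ofReal

/-- The `n`-th normalized Hermite function as an element of `L²(ℝ)`. -/
noncomputable def hermiteL2 (n : ℕ) : L2R :=
  (memLp_hermiteFunction n).toLp (fun x : ℝ => (hermiteFunction n x : ℂ))

theorem orthonormal_hermiteL2 : Orthonormal ℂ hermiteL2 := by
  rw [orthonormal_iff_ite]
  intro m n
  rw [L2.inner_def]
  have : (fun x : ℝ => inner ℂ (hermiteL2 m x) (hermiteL2 n x)) =ᵐ[volume]
      fun x : ℝ => ((hermiteFunction m x * hermiteFunction n x : ℝ) : ℂ) := by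
    filter_upwards [(memLp_hermiteFunction m).coeFn_toLp, (memLp_hermiteFunction n).coeFn_toLp]
      with x hm hn
    unfold hermiteL2
    rw [hm, hn]
    simp [mul_comm]
  rw [integral_congr_ae this, integral_complex_ofReal, integral_hermiteFunction_mul]
  split_ifs <;> simp

/-- The fractional Fourier transform of angle `θ` on `L²(ℝ)`,
`F_θ f = ∑ₙ e^{-inθ} ⟨f, hₙ⟩ hₙ` with the scalar product linear in `f`; the series converges
in `L²(ℝ)` for every `f`, see `hasSum_fractionalFourier`. -/
noncomputable def fractionalFourier (θ : ℝ) (f : L2R) : L2R :=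
  ∑' n : ℕ, (Complex.exp (-(Complex.I * n * θ)) * inner ℂ (hermiteL2 n) f) • hermiteL2 n

theorem hasSum_fractionalFourier (θ : ℝ) (f : L2R) :
    HasSum (fun n : ℕ =>
      (Complex.exp (-(Complex.I * n * θ)) * inner ℂ (hermiteL2 n) f) • hermiteL2 n)
      (fractionalFourier θ f) := by
  refine Summable.hasSum ?_
  have h := (orthonormal_hermiteL2.orthogonalFamily.summable_iff_norm_sq_summable
    (fun n : ℕ => Complex.exp (-(Complex.I * n * θ)) * inner ℂ (hermiteL2 n) f)).2 ?_
  · simpa [LinearIsometry.toSpanSingleton_apply] using h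
  · have hn : ∀ n : ℕ, ‖Complex.exp (-(Complex.I * n * θ))‖ = 1 := by
      intro n
      have : (-(Complex.I * n * θ) : ℂ) = ((-(n * θ) : ℝ) : ℂ) * Complex.I := by
        push_cast; ring
      rw [this, Complex.norm_exp_ofReal_mul_I]
    simp_rw [norm_mul, hn, one_mul]
    exact orthonormal_hermiteL2.inner_products_summable f

/-- The characteristic function of `[0, 1]` as an element of `L²(ℝ)`. -/
noncomputable def unitIntervalIndicator : L2R :=
  indicatorConstLp 2 (measurableSet_Icc : MeasurableSet (Set.Icc (0 : ℝ) 1))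
    measure_Icc_lt_top.ne (1 : ℂ)

/-! Write π(p) for the time-frequency shift by p. The operator `fractionalFourier (-θ)` is unitary
and, up to unimodular factors, conjugates π(p) into π(R_θ p) (`fractionalFourierEquiv_symShift`). It
therefore carries the orthonormal basis G(1_[0,1], ℤ²) to G(g, R_θ ℤ²) up to phases. It also gives
|⟨π(p)g, π(q)g⟩| = |V(R_{-θ}(q - p))|, where V(t, s) = ⟨1_[0,1], π(t, s)1_[0,1]⟩ is an explicit
integral.

For the negative part, suppose G(g, A × B) is an orthonormal basis. Two points of A × B on a common
horizontal or vertical line, at distance u > 0, force |V| ∈ {0, 1} at a point with coordinates ±u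
cos θ, ±u sin θ in some order. Inside the open square |t|, |s| < 1 the function V has no zero, and
|V| < 1 for t ≠ 0. Hence u ≥ d = min(1/|cos θ|, 1/|sin θ|) > 1 (`le_abs_sub_of_isOrthonormalBasis`).
So A × B is d-separated in the maximum norm, which is too sparse: Parseval for the vectors π(z)g,
integrated over z in a square of side d, gives d² ≤ ∫|V|² ≤ 1 (`le_one_of_isOrthonormalBasis`,
`lintegral_unitSpectrogram_le`). -/

/-! ### Time-frequency shifts and their commutation relations. -/

theorem coeFn_timeFrequencyShift (g : L2R) (t s : ℝ) :
    timeFrequencyShift g t s =ᵐ[volume]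
      fun x : ℝ => Complex.exp (2 * Real.pi * Complex.I * s * x) * g (x - t) :=
  (memLp_timeFrequencyShift g t s).coeFn_toLp

theorem ae_comp_sub_right {α : Type*} {f g : ℝ → α} (h : f =ᵐ[volume] g) (t : ℝ) :
    (fun x => f (x - t)) =ᵐ[volume] fun x => g (x - t) :=
  (measurePreserving_sub_right volume t).quasiMeasurePreserving.ae_eq_comp h

theorem norm_modulation (s x : ℝ) : ‖Complex.exp (2 * Real.pi * Complex.I * s * x)‖ = 1 := by
  have h2 : (2 * Real.pi * Complex.I * s * x : ℂ) = ((2 * Real.pi * s * x : ℝ) : ℂ) * Complex.I := by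
    push_cast; ring
  rw [h2, Complex.norm_exp_ofReal_mul_I]

/-- Time-frequency shifts as linear isometries of `L²(ℝ)`. -/
noncomputable def shiftIsometry (t s : ℝ) : L2R →ₗᵢ[ℂ] L2R where
  toFun g := timeFrequencyShift g t s
  map_add' f g := by
    apply Lp.ext
    filter_upwards [coeFn_timeFrequencyShift (f + g) t s, coeFn_timeFrequencyShift f t s,
      coeFn_timeFrequencyShift g t s, ae_comp_sub_right (Lp.coeFn_add f g) t,
      Lp.coeFn_add (timeFrequencyShift f t s) (timeFrequencyShift g t s)] with x h1 h2 h3 h4 h5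
    rw [h1, h5, h4, Pi.add_apply, Pi.add_apply, h2, h3, mul_add]
  map_smul' c f := by
    apply Lp.ext
    filter_upwards [coeFn_timeFrequencyShift (c • f) t s, coeFn_timeFrequencyShift f t s,
      ae_comp_sub_right (Lp.coeFn_smul c f) t,
      Lp.coeFn_smul c (timeFrequencyShift f t s)] with x h1 h2 h4 h5
    simp only [RingHom.id_apply]
    rw [h1, h5, h4, Pi.smul_apply, Pi.smul_apply, h2, smul_eq_mul, smul_eq_mul]
    ring
  norm_map' g := by
    change ‖timeFrequencyShift g t s‖ = ‖g‖
    rw [timeFrequencyShift, Lp.norm_toLp, Lp.norm_def]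
    congr 1
    rw [← eLpNorm_comp_measurePreserving (Lp.aestronglyMeasurable g)
      (measurePreserving_sub_right volume t)]
    refine eLpNorm_congr_norm_ae (Filter.Eventually.of_forall fun x => ?_)
    simp [norm_modulation]

theorem shiftIsometry_apply (t s : ℝ) (g : L2R) :
    shiftIsometry t s g = timeFrequencyShift g t s := rfl

theorem shiftIsometry_shiftIsometry (t s t' s' : ℝ) (g : L2R) :
    shiftIsometry t s (shiftIsometry t' s' g) =
      Complex.exp (-(2 * Real.pi * s' * t : ℝ) * Complex.I) • shiftIsometry (t + t') (s + s') g := by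
  apply Lp.ext
  simp only [shiftIsometry_apply]
  filter_upwards [coeFn_timeFrequencyShift (timeFrequencyShift g t' s') t s,
    coeFn_timeFrequencyShift g (t + t') (s + s'),
    ae_comp_sub_right (coeFn_timeFrequencyShift g t' s') t,
    Lp.coeFn_smul (Complex.exp (-(2 * Real.pi * s' * t : ℝ) * Complex.I))
      (timeFrequencyShift g (t + t') (s + s'))] with x h1 h2 h3 h4
  rw [h1, h4, Pi.smul_apply, h2, h3, smul_eq_mul, ← mul_assoc, ← mul_assoc, ← Complex.exp_add,
    ← Complex.exp_add, sub_sub]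
  congr 2
  push_cast
  ring

/-- The symmetrically normalized time-frequency shift `e^{-πits} π(t, s)`. -/
noncomputable def symShift (p : ℝ × ℝ) (g : L2R) : L2R :=
  Complex.exp (-(Real.pi * p.1 * p.2 : ℝ) * Complex.I) • shiftIsometry p.1 p.2 g

/-- The symmetric normalization makes the cocycle depend only on the symplectic form of p and q,
which rotations preserve. This is what makes an exact covariance with rotations possible. -/
theorem symShift_symShift (p q : ℝ × ℝ) (g : L2R) :
    symShift p (symShift q g) =
      Complex.exp ((Real.pi * (q.1 * p.2 - q.2 * p.1) : ℝ) * Complex.I) • symShift (p + q) g := by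
  simp only [symShift, map_smul, shiftIsometry_shiftIsometry, smul_smul, ← Complex.exp_add,
    Prod.fst_add, Prod.snd_add]
  congr 2
  push_cast
  ring

theorem shiftIsometry_eq_symShift (p : ℝ × ℝ) (g : L2R) :
    shiftIsometry p.1 p.2 g =
      Complex.exp ((Real.pi * p.1 * p.2 : ℝ) * Complex.I) • symShift p g := by
  rw [symShift, smul_smul, ← Complex.exp_add]
  simp

theorem norm_inner_symShift_symShift (p q : ℝ × ℝ) (f g : L2R) :
    ‖inner ℂ (symShift p f) (symShift q g)‖ = ‖inner ℂ f (symShift (q - p) g)‖ := by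
  have h := symShift_symShift p (q - p) g
  rw [add_sub_cancel] at h
  have h2 : ‖inner ℂ (symShift p f) (symShift p (symShift (q - p) g))‖
      = ‖inner ℂ (symShift p f) (symShift q g)‖ := by
    rw [h, inner_smul_right, norm_mul, Complex.norm_exp_ofReal_mul_I, one_mul]
  rw [← h2]
  conv_lhs => rw [symShift, symShift]
  rw [inner_smul_left, inner_smul_right, (shiftIsometry p.1 p.2).inner_map_map, norm_mul, norm_mul,
    RCLike.norm_conj]
  have : ‖Complex.exp (-(Real.pi * p.1 * p.2 : ℝ) * Complex.I)‖ = 1 := by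
    have := Complex.norm_exp_ofReal_mul_I (-(Real.pi * p.1 * p.2))
    push_cast at this ⊢
    exact this
  rw [this, one_mul, one_mul]

theorem norm_inner_shift_shift (p q : ℝ × ℝ) (f g : L2R) :
    ‖inner ℂ (shiftIsometry p.1 p.2 f) (shiftIsometry q.1 q.2 g)‖
      = ‖inner ℂ f (shiftIsometry (q - p).1 (q - p).2 g)‖ := by
  simp only [shiftIsometry_eq_symShift]
  rw [inner_smul_left, inner_smul_right, inner_smul_right, norm_mul, norm_mul, norm_mul,
    RCLike.norm_conj, norm_inner_symShift_symShift]
  simp only [Complex.norm_exp_ofReal_mul_I, one_mul]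

/-! ### Generating function of the Hermite functions and shifts of the Gaussian. -/

theorem iteratedDeriv_exp_hermite (y : ℂ) (n : ℕ) :
    iteratedDeriv n (fun w : ℂ => Complex.exp (y * w - w ^ 2 / 2)) =
      fun w => Polynomial.aeval (y - w) (Polynomial.hermite n)
        * Complex.exp (y * w - w ^ 2 / 2) := by
  induction n with
  | zero => simp
  | succ n ih =>
    rw [iteratedDeriv_succ, ih]
    funext w
    have h1 : HasDerivAt (fun w : ℂ => y - w) (-1) w := by
      simpa using (hasDerivAt_id w).const_sub y
    have h2 := ((Polynomial.hasDerivAt_aeval (Polynomial.hermite n) (y - w)).comp w h1)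
    have h3 : HasDerivAt (fun w : ℂ => Complex.exp (y * w - w ^ 2 / 2))
        (Complex.exp (y * w - w ^ 2 / 2) * (y - w)) w := by
      have := (((hasDerivAt_id w).const_mul y).sub ((hasDerivAt_pow 2 w).div_const 2)).cexp
      refine this.congr_deriv ?_
      simp
    refine ((h2.mul h3).congr_deriv ?_).deriv
    rw [Polynomial.hermite_succ]
    simp only [map_sub, map_mul, Polynomial.aeval_X, Function.comp]
    ring

/-- This is the Taylor series at 0 of an entire function of w. -/
theorem hasSum_hermite (y w : ℂ) :
    HasSum (fun n : ℕ => w ^ n / n.factorial * Polynomial.aeval y (Polynomial.hermite n))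
      (Complex.exp (y * w - w ^ 2 / 2)) := by
  have hd : Differentiable ℂ fun w : ℂ => Complex.exp (y * w - w ^ 2 / 2) := by fun_prop
  have h := Complex.hasSum_taylorSeries_of_entire hd 0 w
  simp only [iteratedDeriv_exp_hermite] at h
  refine h.congr_fun fun n => ?_
  simp
  ring

/-- The function `x ↦ 2^{1/4} e^{2√π x w - w²/2 - πx²}` generating the Hermite functions. -/
noncomputable def hermiteGenerating (w : ℂ) (x : ℝ) : ℂ :=
  ((2 : ℝ) ^ (1 / 4 : ℝ) : ℝ) *
    Complex.exp (2 * Real.sqrt Real.pi * x * w - w ^ 2 / 2 - Real.pi * x ^ 2)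

theorem hasSum_hermiteFunction (w : ℂ) (x : ℝ) :
    HasSum (fun n : ℕ => w ^ n / Real.sqrt n.factorial * (hermiteFunction n x : ℂ))
      (hermiteGenerating w x) := by
  have h := ((hasSum_hermite ((2 * Real.sqrt Real.pi * x : ℝ) : ℂ) w).mul_left
    (((2 : ℝ) ^ (1 / 4 : ℝ) : ℝ) * Complex.exp (-Real.pi * x ^ 2)))
  have hv : ((2 : ℝ) ^ (1 / 4 : ℝ) : ℝ) * Complex.exp (-Real.pi * x ^ 2) *
      Complex.exp (((2 * Real.sqrt Real.pi * x : ℝ) : ℂ) * w - w ^ 2 / 2)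
        = hermiteGenerating w x := by
    rw [hermiteGenerating, mul_assoc, ← Complex.exp_add]
    congr 2
    push_cast
    ring
  rw [hv] at h
  refine h.congr_fun fun n => ?_
  · have ha : (Polynomial.aeval ((2 * Real.sqrt Real.pi * x : ℝ) : ℂ) (Polynomial.hermite n))
        = ((Polynomial.aeval (2 * Real.sqrt Real.pi * x) (Polynomial.hermite n) : ℝ) : ℂ) := by
      exact Polynomial.aeval_algebraMap_apply ℂ (2 * Real.sqrt Real.pi * x) (Polynomial.hermite n)
    have hs : ((n.factorial : ℝ) : ℂ) = (Real.sqrt n.factorial : ℂ) * Real.sqrt n.factorial := by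
      rw [← Complex.ofReal_mul, Real.mul_self_sqrt (by positivity)]
    have hn : (Real.sqrt n.factorial : ℂ) ≠ 0 := by
      rw [Complex.ofReal_ne_zero]; positivity
    rw [ha, hermiteFunction]
    push_cast at hs ⊢
    rw [hs]
    field_simp

theorem summable_hermite_coeff (w : ℂ) :
    Summable fun n : ℕ => (w ^ n / (Real.sqrt n.factorial : ℂ)) • hermiteL2 n := by
  have h := (orthonormal_hermiteL2.orthogonalFamily.summable_iff_norm_sq_summable
    (fun n : ℕ => w ^ n / (Real.sqrt n.factorial : ℂ))).2 ?_
  · simpa [LinearIsometry.toSpanSingleton_apply] using h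
  · have := Real.summable_pow_div_factorial (‖w‖ ^ 2)
    refine this.congr fun n => ?_
    rw [norm_div, div_pow, norm_pow, Complex.norm_real, Real.norm_of_nonneg (Real.sqrt_nonneg _),
      Real.sq_sqrt (by positivity), ← pow_mul, ← pow_mul, mul_comm]

/-- The vector `∑ₙ wⁿ / √n! hₙ` of `L²(ℝ)`. -/
noncomputable def hermiteCoherent (w : ℂ) : L2R :=
  ∑' n : ℕ, (w ^ n / (Real.sqrt n.factorial : ℂ)) • hermiteL2 n

theorem hasSum_hermiteCoherent (w : ℂ) :
    HasSum (fun n : ℕ => (w ^ n / (Real.sqrt n.factorial : ℂ)) • hermiteL2 n)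
      (hermiteCoherent w) :=
  (summable_hermite_coeff w).hasSum

theorem coeFn_hermiteL2 (n : ℕ) : hermiteL2 n =ᵐ[volume] fun x => (hermiteFunction n x : ℂ) :=
  (memLp_hermiteFunction n).coeFn_toLp

/-- The series converges in L² and also pointwise. A subsequence of the L² partial sums converges
almost everywhere, so the two limits agree. -/
theorem coeFn_hermiteCoherent (w : ℂ) :
    hermiteCoherent w =ᵐ[volume] hermiteGenerating w := by
  have h1 := (hasSum_hermiteCoherent w).tendsto_sum_nat
  obtain ⟨ns, hns, hae⟩ := (tendstoInMeasure_of_tendsto_Lp h1).exists_seq_tendsto_ae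
  have h2 : ∀ N : ℕ, ∀ᵐ x : ℝ,
      (∑ n ∈ Finset.range N, (w ^ n / (Real.sqrt n.factorial : ℂ)) • hermiteL2 n : L2R) x =
        ∑ n ∈ Finset.range N, w ^ n / Real.sqrt n.factorial * (hermiteFunction n x : ℂ) := by
    intro N
    induction N with
    | zero =>
      filter_upwards [Lp.coeFn_zero ℂ 2 (volume : Measure ℝ)] with x hx
      simp
    | succ N ih =>
      simp only [Finset.sum_range_succ]
      filter_upwards [ih, Lp.coeFn_add
        (∑ n ∈ Finset.range N, (w ^ n / (Real.sqrt n.factorial : ℂ)) • hermiteL2 n)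
        ((w ^ N / (Real.sqrt N.factorial : ℂ)) • hermiteL2 N),
        Lp.coeFn_smul (w ^ N / (Real.sqrt N.factorial : ℂ)) (hermiteL2 N),
        coeFn_hermiteL2 N] with x h3 h4 h5 h6
      rw [h4, Pi.add_apply, h3, h5, Pi.smul_apply, h6, smul_eq_mul]
  filter_upwards [hae, ae_all_iff.2 h2] with x hx h3
  refine tendsto_nhds_unique hx ?_
  simp only [h3]
  exact (hasSum_hermiteFunction w x).tendsto_sum_nat.comp hns.tendsto_atTop

theorem inner_hermiteL2_hermiteCoherent (n : ℕ) (w : ℂ) :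
    inner ℂ (hermiteL2 n) (hermiteCoherent w) = w ^ n / (Real.sqrt n.factorial : ℂ) := by
  have h := (hasSum_hermiteCoherent w).mapL (innerSL ℂ (hermiteL2 n))
  refine h.unique ?_
  have h2 := hasSum_ite_eq n (w ^ n / (Real.sqrt n.factorial : ℂ))
  refine h2.congr_fun fun m => ?_
  have := orthonormal_iff_ite.1 orthonormal_hermiteL2 n m
  rw [innerSL_apply_apply, inner_smul_right, this]
  split_ifs with h3 h4 h4
  · subst h3; simp
  · exact absurd h3.symm h4
  · exact absurd h4.symm h3
  · simp

/-- The n-th coefficient is a multiple of wⁿ, so the multiplier e^{-inθ} is absorbed into w. -/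
theorem fractionalFourier_hermiteCoherent (θ : ℝ) (w : ℂ) :
    fractionalFourier θ (hermiteCoherent w) = hermiteCoherent (Complex.exp (-(Complex.I * θ)) * w) := by
  refine (hasSum_fractionalFourier θ _).unique ?_
  convert hasSum_hermiteCoherent (Complex.exp (-(Complex.I * θ)) * w) using 2 with n
  rw [inner_hermiteL2_hermiteCoherent, mul_pow, ← Complex.exp_nat_mul, mul_div_assoc]
  congr 3
  ring

/-- Identifying the phase plane with ℂ by w = √π(t + is) turns the rotation of w by the fractional
Fourier transform into a rotation of time-frequency shifts of the Gaussian. -/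
theorem symShift_hermiteL2_zero (p : ℝ × ℝ) :
    symShift p (hermiteL2 0) = (Real.exp (-(Real.pi * (p.1 ^ 2 + p.2 ^ 2) / 2)) : ℂ) •
      hermiteCoherent (Real.sqrt Real.pi * (p.1 + p.2 * Complex.I)) := by
  apply Lp.ext
  set w : ℂ := Real.sqrt Real.pi * (p.1 + p.2 * Complex.I) with hw
  filter_upwards [Lp.coeFn_smul (Complex.exp (-(Real.pi * p.1 * p.2 : ℝ) * Complex.I))
      (timeFrequencyShift (hermiteL2 0) p.1 p.2),
    coeFn_timeFrequencyShift (hermiteL2 0) p.1 p.2,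
    ae_comp_sub_right (coeFn_hermiteL2 0) p.1,
    Lp.coeFn_smul (Real.exp (-(Real.pi * (p.1 ^ 2 + p.2 ^ 2) / 2)) : ℂ) (hermiteCoherent w),
    coeFn_hermiteCoherent w] with x h1 h2 h3 h4 h5
  rw [symShift, shiftIsometry_apply, h1, h4, Pi.smul_apply, Pi.smul_apply, h2, h3, h5,
    hermiteFunction, hermiteGenerating]
  simp only [Nat.factorial_zero, Nat.cast_one, Real.sqrt_one, div_one, Polynomial.hermite_zero,
    map_one, mul_one, smul_eq_mul, Complex.ofReal_mul, Complex.ofReal_exp]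
  have hpi : (Real.sqrt Real.pi : ℂ) ^ 2 = Real.pi := by
    rw [← Complex.ofReal_pow, Real.sq_sqrt Real.pi_pos.le]
  have key : ∀ a b c d e A : ℂ, a + (b + c) = d + e →
      Complex.exp a * (Complex.exp b * (A * Complex.exp c)) =
        Complex.exp d * (A * Complex.exp e) := by
    intro a b c d e A h
    have := congrArg Complex.exp h
    rw [Complex.exp_add, Complex.exp_add, Complex.exp_add] at this
    linear_combination A * this
  apply key
  push_cast
  rw [hw]
  linear_combination (2 * x * (p.1 + p.2 * Complex.I) -
    (p.1 + p.2 * Complex.I) ^ 2 / 2) * (- hpi) + (Real.pi * p.2 ^ 2 / 2 : ℂ) * Complex.I_sq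

/-! ### Completeness of the Gaussian shifts and of the Hermite functions. -/

open scoped FourierTransform ContDiff in
/-- An integrable function with vanishing Fourier transform vanishes almost everywhere. -/
theorem ae_eq_zero_of_fourier_eq_zero {f : ℝ → ℂ} (hf : Integrable f)
    (h : ∀ s, 𝓕 f s = 0) : f =ᵐ[volume] 0 := by
  refine ae_eq_zero_of_integral_contDiff_smul_eq_zero hf.locallyIntegrable fun g hg hgc => ?_
  have hg₁ : HasCompactSupport (Complex.ofRealCLM ∘ g) := hgc.comp_left rfl
  have hg₂ : ContDiff ℝ ∞ (Complex.ofRealCLM ∘ g) := by fun_prop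
  set G : SchwartzMap ℝ ℂ := hg₁.toSchwartzMap hg₂ with hG
  have hsa : ∀ φ : SchwartzMap ℝ ℂ, ∫ ξ, 𝓕 f ξ * φ ξ = ∫ x, f x * (𝓕 φ) x := fun φ => by
    simpa using! VectorFourier.integral_bilin_fourierIntegral_eq_flip (.mul ℂ ℂ) (L := innerₗ ℝ)
      Real.continuous_fourierChar continuous_inner hf (φ.integrable (μ := volume))
  -- Every test function is the Fourier transform of a Schwartz function, so the transform can be
  -- moved onto f.
  have h1 := hsa (𝓕⁻ G)
  rw [FourierTransform.fourier_fourierInv_eq] at h1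
  simp only [h, zero_mul, integral_zero] at h1
  rw [h1]
  refine integral_congr_ae (Filter.Eventually.of_forall fun x => ?_)
  simp [hG, mul_comm]

theorem coeFn_symShift (p : ℝ × ℝ) (g : L2R) :
    symShift p g =ᵐ[volume] fun x : ℝ => Complex.exp (-(Real.pi * p.1 * p.2 : ℝ) * Complex.I) *
      (Complex.exp (2 * Real.pi * Complex.I * p.2 * x) * g (x - p.1)) := by
  filter_upwards [Lp.coeFn_smul (Complex.exp (-(Real.pi * p.1 * p.2 : ℝ) * Complex.I))
      (timeFrequencyShift g p.1 p.2), coeFn_timeFrequencyShift g p.1 p.2] with x h1 h2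
  rw [symShift, shiftIsometry_apply, h1, Pi.smul_apply, h2, smul_eq_mul]

theorem hermiteFunction_zero_pos (x : ℝ) : 0 < hermiteFunction 0 x := by
  simp only [hermiteFunction, Polynomial.hermite_zero, map_one]
  positivity

open scoped FourierTransform in
-- Pure modulations suffice: their inner products with f are the Fourier transform of the integrable
-- function h₀f, and h₀ has no zeros.
theorem eq_zero_of_inner_symShift_hermiteL2_zero {f : L2R}
    (h : ∀ p, inner ℂ (symShift p (hermiteL2 0)) f = 0) : f = 0 := by
  have hi : Integrable (fun x : ℝ => (hermiteFunction 0 x : ℂ) * f x) :=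
    (memLp_hermiteFunction 0).integrable_mul (Lp.memLp f)
  have h0 := ae_eq_zero_of_fourier_eq_zero hi fun s => by
    rw [Real.fourier_real_eq_integral_exp_smul, ← h (0, s), L2.inner_def]
    refine integral_congr_ae ?_
    filter_upwards [coeFn_symShift (0, s) (hermiteL2 0), ae_comp_sub_right (coeFn_hermiteL2 0) 0]
      with x h1 h2
    rw [h1, h2]
    have hc : (starRingEnd ℂ) (2 * Real.pi * Complex.I * s * x) =
        ((-2 * Real.pi * x * s : ℝ) : ℂ) * Complex.I := by
      simp only [map_mul, Complex.conj_ofReal, Complex.conj_I, map_ofNat]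
      push_cast
      ring
    simp only [sub_zero, RCLike.inner_apply, map_mul, Complex.conj_ofReal, ← Complex.exp_conj, hc,
      mul_zero, zero_mul, Complex.ofReal_zero, neg_zero, Complex.exp_zero, one_mul,
      smul_eq_mul]
    ring
  apply Lp.ext
  filter_upwards [h0, Lp.coeFn_zero ℂ 2 (volume : Measure ℝ)] with x hx hz
  rw [hz]
  simpa [(hermiteFunction_zero_pos x).ne'] using hx

theorem orthogonal_span_range_eq_bot {ι : Type*} {v : ι → L2R}
    (h : ∀ f, (∀ i, inner ℂ (v i) f = 0) → f = 0) :
    (Submodule.span ℂ (Set.range v))ᗮ = ⊥ := by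
  rw [Submodule.eq_bot_iff]
  intro f hf
  exact h f fun i => (Submodule.mem_orthogonal _ f).1 hf _ (Submodule.subset_span ⟨i, rfl⟩)

/-- The shifts of the Gaussian are L² sums of Hermite functions, so their completeness passes to the
Hermite functions. -/
theorem eq_zero_of_inner_hermiteL2 {f : L2R} (h : ∀ n, inner ℂ (hermiteL2 n) f = 0) : f = 0 := by
  refine eq_zero_of_inner_symShift_hermiteL2_zero fun p => ?_
  rw [symShift_hermiteL2_zero, inner_smul_left]
  have hw : ∀ w, inner ℂ f (hermiteCoherent w) = 0 := by
    intro w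
    refine ((hasSum_hermiteCoherent w).mapL (innerSL ℂ f)).unique ?_
    refine hasSum_zero.congr_fun fun n => ?_
    rw [innerSL_apply_apply, inner_smul_right, inner_eq_zero_symm.1 (h n), mul_zero]
  rw [inner_eq_zero_symm.1 (hw _), mul_zero]

/-- The Hermite functions as a Hilbert basis of `L²(ℝ)`. -/
noncomputable def hermiteBasis : HilbertBasis ℕ ℂ L2R :=
  HilbertBasis.mkOfOrthogonalEqBot orthonormal_hermiteL2
    (orthogonal_span_range_eq_bot fun _ => eq_zero_of_inner_hermiteL2)

theorem hermiteBasis_apply (n : ℕ) : hermiteBasis n = hermiteL2 n :=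
  congrFun (HilbertBasis.coe_mkOfOrthogonalEqBot _ _) n

theorem ext_inner_hermiteL2 {f g : L2R}
    (h : ∀ n, inner ℂ (hermiteL2 n) f = inner ℂ (hermiteL2 n) g) : f = g := by
  rw [← sub_eq_zero]
  refine eq_zero_of_inner_hermiteL2 fun n => ?_
  rw [inner_sub_right, h, sub_self]

/-! ### Unitarity of the fractional Fourier transform and its covariance with rotations. -/

theorem inner_hermiteL2_fractionalFourier (θ : ℝ) (n : ℕ) (f : L2R) :
    inner ℂ (hermiteL2 n) (fractionalFourier θ f) =
      Complex.exp (-(Complex.I * n * θ)) * inner ℂ (hermiteL2 n) f := by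
  have h := (hasSum_fractionalFourier θ f).mapL (innerSL ℂ (hermiteL2 n))
  refine h.unique ?_
  refine (hasSum_ite_eq n (Complex.exp (-(Complex.I * n * θ)) *
    inner ℂ (hermiteL2 n) f)).congr_fun fun m => ?_
  rw [innerSL_apply_apply, inner_smul_right, orthonormal_iff_ite.1 orthonormal_hermiteL2 n m]
  by_cases h3 : m = n
  · subst h3; simp
  · rw [if_neg h3, if_neg (Ne.symm h3), mul_zero]

theorem norm_exp_neg_I_mul (n : ℕ) (θ : ℝ) : ‖Complex.exp (-(Complex.I * n * θ))‖ = 1 := by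
  have : (-(Complex.I * n * θ) : ℂ) = ((-(n * θ) : ℝ) : ℂ) * Complex.I := by
    push_cast; ring
  rw [this, Complex.norm_exp_ofReal_mul_I]

/-- The fractional Fourier transform as a unitary operator. -/
noncomputable def fractionalFourierEquiv (θ : ℝ) : L2R ≃ₗᵢ[ℂ] L2R where
  toFun := fractionalFourier θ
  invFun := fractionalFourier (-θ)
  map_add' f g := ext_inner_hermiteL2 fun n => by
    simp only [inner_add_right, inner_hermiteL2_fractionalFourier]; ring
  map_smul' c f := ext_inner_hermiteL2 fun n => by
    simp only [inner_smul_right, inner_hermiteL2_fractionalFourier, RingHom.id_apply]; ring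
  left_inv f := ext_inner_hermiteL2 fun n => by
    simp only [inner_hermiteL2_fractionalFourier, ← mul_assoc, ← Complex.exp_add]
    simp
  right_inv f := ext_inner_hermiteL2 fun n => by
    simp only [inner_hermiteL2_fractionalFourier, ← mul_assoc, ← Complex.exp_add]
    simp
  norm_map' f := by
    have h : inner ℂ (fractionalFourier θ f) (fractionalFourier θ f) = inner ℂ f f := by
      refine (hermiteBasis.hasSum_inner_mul_inner _ _).unique ?_
      refine (hermiteBasis.hasSum_inner_mul_inner f f).congr_fun fun n => ?_
      rw [← inner_conj_symm _ (hermiteBasis n), ← inner_conj_symm f (hermiteBasis n),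
        RCLike.conj_mul, RCLike.conj_mul, hermiteBasis_apply, inner_hermiteL2_fractionalFourier,
        norm_mul, norm_exp_neg_I_mul, one_mul]
    change ‖fractionalFourier θ f‖ = ‖f‖
    rw [@norm_eq_sqrt_re_inner ℂ, h, ← norm_eq_sqrt_re_inner]

theorem fractionalFourierEquiv_apply (θ : ℝ) (f : L2R) :
    fractionalFourierEquiv θ f = fractionalFourier θ f := rfl

theorem fractionalFourier_symShift_hermiteL2_zero (θ : ℝ) (p : ℝ × ℝ) :
    fractionalFourierEquiv (-θ) (symShift p (hermiteL2 0)) =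
      symShift (planeRotation θ p) (hermiteL2 0) := by
  rw [symShift_hermiteL2_zero, symShift_hermiteL2_zero, map_smul, fractionalFourierEquiv_apply,
    fractionalFourier_hermiteCoherent]
  have hr : (planeRotation θ p).1 ^ 2 + (planeRotation θ p).2 ^ 2 = p.1 ^ 2 + p.2 ^ 2 := by
    simp only [planeRotation]
    linear_combination (p.1 ^ 2 + p.2 ^ 2) * Real.sin_sq_add_cos_sq θ
  rw [hr]
  simp only [planeRotation]
  congr 2
  · have : -(Complex.I * ((-θ : ℝ) : ℂ)) = θ * Complex.I := by push_cast; ring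
    rw [this, Complex.exp_mul_I, ← Complex.ofReal_cos, ← Complex.ofReal_sin]
    push_cast
    linear_combination (Real.sqrt Real.pi * Complex.sin θ * p.2) * Complex.I_sq

/-- The fractional Fourier transform rotates time-frequency shifts. -/
theorem fractionalFourierEquiv_symShift (θ : ℝ) (p : ℝ × ℝ) (g : L2R) :
    fractionalFourierEquiv (-θ) (symShift p g) =
      symShift (planeRotation θ p) (fractionalFourierEquiv (-θ) g) := by
  let c : ℝ × ℝ → ℂ := fun p => Complex.exp (-(Real.pi * p.1 * p.2 : ℝ) * Complex.I)
  let ρ : ℝ × ℝ → L2R →L[ℂ] L2R := fun p => c p • (shiftIsometry p.1 p.2).toContinuousLinearMap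
  let U : L2R →L[ℂ] L2R := (fractionalFourierEquiv (-θ)).toLinearIsometry.toContinuousLinearMap
  have hd : Dense (Submodule.span ℂ (Set.range fun q => symShift q (hermiteL2 0)) : Set L2R) := by
    rw [Submodule.dense_iff_topologicalClosure_eq_top, Submodule.topologicalClosure_eq_top_iff]
    exact orthogonal_span_range_eq_bot fun _ => eq_zero_of_inner_symShift_hermiteL2_zero
  -- Both sides are bounded, so it suffices to compare them on the Gaussian shifts. There the
  -- products of shifts have equal cocycles, because the rotation has determinant 1.
  have h : U ∘L ρ p = ρ (planeRotation θ p) ∘L U := by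
    refine ContinuousLinearMap.ext_on hd ?_
    rintro _ ⟨q, rfl⟩
    change fractionalFourierEquiv (-θ) (symShift p (symShift q (hermiteL2 0))) =
      symShift (planeRotation θ p) (fractionalFourierEquiv (-θ) (symShift q (hermiteL2 0)))
    rw [fractionalFourier_symShift_hermiteL2_zero, symShift_symShift, symShift_symShift, map_smul,
      fractionalFourier_symShift_hermiteL2_zero]
    have h1 : (planeRotation θ q).1 * (planeRotation θ p).2 -
        (planeRotation θ q).2 * (planeRotation θ p).1 = q.1 * p.2 - q.2 * p.1 := by
      simp only [planeRotation]
      linear_combination (q.1 * p.2 - q.2 * p.1) * Real.sin_sq_add_cos_sq θ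
    have h2 : planeRotation θ (p + q) = planeRotation θ p + planeRotation θ q := by
      simp only [planeRotation, Prod.fst_add, Prod.snd_add, Prod.mk_add_mk, Prod.mk.injEq]
      constructor <;> ring
    rw [h1, h2]
  exact DFunLike.congr_fun h g

/-! ### The ambiguity function of the unit interval. -/

theorem coeFn_unitIntervalIndicator :
    unitIntervalIndicator =ᵐ[volume] (Set.Icc (0 : ℝ) 1).indicator fun _ => (1 : ℂ) :=
  indicatorConstLp_coeFn

theorem norm_unitIntervalIndicator : ‖unitIntervalIndicator‖ = 1 := by
  simp [unitIntervalIndicator, norm_indicatorConstLp]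

theorem inner_shift_unitIntervalIndicator (t s : ℝ) (f : L2R) :
    inner ℂ (shiftIsometry t s unitIntervalIndicator) f =
      ∫ x in Set.Icc t (t + 1), Complex.exp (-(2 * Real.pi * Complex.I * s * x)) * f x := by
  rw [← integral_indicator measurableSet_Icc, L2.inner_def]
  refine integral_congr_ae ?_
  filter_upwards [coeFn_timeFrequencyShift unitIntervalIndicator t s,
    ae_comp_sub_right coeFn_unitIntervalIndicator t] with x h1 h2
  rw [shiftIsometry_apply, h1, h2]
  have hc : (starRingEnd ℂ) (2 * Real.pi * Complex.I * s * x) =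
      -(2 * Real.pi * Complex.I * s * x) := by
    simp only [map_mul, Complex.conj_ofReal, Complex.conj_I, map_ofNat]
    ring
  have hm : x - t ∈ Set.Icc (0 : ℝ) 1 ↔ x ∈ Set.Icc t (t + 1) := by
    simp only [Set.mem_Icc]
    constructor <;> rintro ⟨h3, h4⟩ <;> constructor <;> linarith
  by_cases hx : x ∈ Set.Icc t (t + 1)
  · rw [Set.indicator_of_mem hx, Set.indicator_of_mem (hm.2 hx), mul_one, RCLike.inner_apply,
      ← Complex.exp_conj, hc, mul_comm]
  · rw [Set.indicator_of_notMem hx, Set.indicator_of_notMem (fun h => hx (hm.1 h)), mul_zero,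
      inner_zero_left]

theorem ambiguity_unitIntervalIndicator (t s : ℝ) :
    inner ℂ unitIntervalIndicator (shiftIsometry t s unitIntervalIndicator) =
      ∫ x in Set.Icc (max 0 t) (min 1 (t + 1)), Complex.exp (2 * Real.pi * Complex.I * s * x) := by
  rw [← Set.Icc_inter_Icc, ← integral_indicator (measurableSet_Icc.inter measurableSet_Icc),
    L2.inner_def]
  refine integral_congr_ae ?_
  filter_upwards [coeFn_unitIntervalIndicator, coeFn_timeFrequencyShift unitIntervalIndicator t s,
    ae_comp_sub_right coeFn_unitIntervalIndicator t] with x h0 h1 h2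
  rw [shiftIsometry_apply, h1, h2, h0, Set.inter_comm, ← Set.indicator_indicator]
  have hm : x - t ∈ Set.Icc (0 : ℝ) 1 ↔ x ∈ Set.Icc t (t + 1) := by
    simp only [Set.mem_Icc]
    constructor <;> rintro ⟨h3, h4⟩ <;> constructor <;> linarith
  by_cases hx : x ∈ Set.Icc t (t + 1)
  · rw [Set.indicator_of_mem hx, Set.indicator_of_mem (hm.2 hx), mul_one, RCLike.inner_apply]
    by_cases hy : x ∈ Set.Icc (0 : ℝ) 1
    · simp [Set.indicator_of_mem hy]
    · simp [Set.indicator_of_notMem hy]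
  · rw [Set.indicator_of_notMem hx, Set.indicator_of_notMem (fun h => hx (hm.1 h)), mul_zero,
      inner_zero_right]

theorem min_sub_max_eq (t : ℝ) : min 1 (t + 1) - max 0 t = 1 - |t| := by
  rcases le_total 0 t with h | h
  · rw [min_eq_left (by linarith), max_eq_right h, abs_of_nonneg h]
  · rw [min_eq_right (by linarith), max_eq_left h, abs_of_nonpos h]; ring

theorem ambiguity_eq_zero_of_one_le {t : ℝ} (ht : 1 ≤ |t|) (s : ℝ) :
    inner ℂ unitIntervalIndicator (shiftIsometry t s unitIntervalIndicator) = 0 := by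
  rw [ambiguity_unitIntervalIndicator]
  refine setIntegral_measure_zero _ ?_
  rw [Real.volume_Icc, min_sub_max_eq, ENNReal.ofReal_eq_zero]
  linarith

theorem norm_ambiguity_le {t : ℝ} (ht : |t| ≤ 1) (s : ℝ) :
    ‖inner ℂ unitIntervalIndicator (shiftIsometry t s unitIntervalIndicator)‖ ≤ 1 - |t| := by
  rw [ambiguity_unitIntervalIndicator]
  refine (norm_setIntegral_le_of_norm_le_const (C := 1) measure_Icc_lt_top
    fun x _ => (norm_modulation s x).le).trans ?_
  rw [measureReal_def, Real.volume_Icc, min_sub_max_eq, ENNReal.toReal_ofReal (by linarith), one_mul]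

theorem mul_ambiguity {t : ℝ} (ht : |t| ≤ 1) {s : ℝ} (hs : s ≠ 0) :
    2 * Real.pi * Complex.I * s *
      inner ℂ unitIntervalIndicator (shiftIsometry t s unitIntervalIndicator) =
      Complex.exp (2 * Real.pi * Complex.I * s * (min 1 (t + 1) : ℝ)) -
        Complex.exp (2 * Real.pi * Complex.I * s * (max 0 t : ℝ)) := by
  have hle : max 0 t ≤ min 1 (t + 1) := by
    rw [← sub_nonneg, min_sub_max_eq]; linarith
  have hc : 2 * Real.pi * Complex.I * s ≠ 0 := by
    simp [hs, Real.pi_ne_zero, Complex.I_ne_zero]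
  rw [ambiguity_unitIntervalIndicator, integral_Icc_eq_integral_Ioc,
    ← intervalIntegral.integral_of_le hle, integral_exp_mul_complex hc]
  have hs' : (s : ℂ) ≠ 0 := Complex.ofReal_ne_zero.2 hs
  field_simp

/-- For |t| < 1 this is the integral of e^{2πisx} over an interval of length 1 - |t|. It vanishes
only if s(1 - |t|) is a nonzero integer, and then |s| ≥ 1. -/
theorem one_le_abs_of_ambiguity_eq_zero {t s : ℝ}
    (h : inner ℂ unitIntervalIndicator (shiftIsometry t s unitIntervalIndicator) = 0) :
    1 ≤ |t| ∨ 1 ≤ |s| := by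
  by_contra! hlt
  obtain ⟨ht, hs⟩ := hlt
  have h0 : s ≠ 0 := by
    rintro rfl
    rw [ambiguity_unitIntervalIndicator] at h
    simp [min_sub_max_eq, measureReal_def] at h
    rw [ENNReal.toReal_ofReal (by linarith)] at h
    linarith
  have h1 := mul_ambiguity ht.le h0
  rw [h, mul_zero, eq_comm, sub_eq_zero, Complex.exp_eq_exp_iff_exists_int] at h1
  obtain ⟨n, hn⟩ := h1
  have h2 : s * (min 1 (t + 1) - max 0 t) = n := by
    have hp : (2 * Real.pi * Complex.I : ℂ) ≠ 0 := by simp [Real.pi_ne_zero, Complex.I_ne_zero]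
    have : (2 * Real.pi * Complex.I : ℂ) * ((s * (min 1 (t + 1) - max 0 t) : ℝ) : ℂ)
        = (2 * Real.pi * Complex.I : ℂ) * ((n : ℝ) : ℂ) := by
      push_cast at hn ⊢
      linear_combination hn
    exact_mod_cast mul_left_cancel₀ hp this
  rw [min_sub_max_eq] at h2
  have h3 : |(n : ℝ)| < 1 := by
    rw [← h2, abs_mul, abs_of_pos (by linarith : 0 < 1 - |t|)]
    nlinarith [abs_nonneg s, abs_nonneg t]
  have h4 : n = 0 := by
    rw [← Int.cast_abs] at h3
    exact Int.abs_lt_one_iff.1 (by exact_mod_cast h3)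
  rw [h4, Int.cast_zero] at h2
  rcases mul_eq_zero.1 h2 with h5 | h5
  · exact h0 h5
  · linarith

theorem ambiguity_int_eq_zero {n : ℤ} (hn : n ≠ 0) :
    inner ℂ unitIntervalIndicator (shiftIsometry 0 n unitIntervalIndicator) = 0 := by
  have hn' : (n : ℝ) ≠ 0 := by exact_mod_cast hn
  have h := mul_ambiguity (t := 0) (by simp) hn'
  have hc : 2 * Real.pi * Complex.I * ((n : ℝ) : ℂ) ≠ 0 := by
    simp [hn, Real.pi_ne_zero, Complex.I_ne_zero]
  have h1 : Complex.exp (2 * Real.pi * Complex.I * ((n : ℝ) : ℂ)) = 1 := by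
    rw [Complex.exp_eq_one_iff]
    exact ⟨n, by push_cast; ring⟩
  simp only [zero_add, min_self, max_self, Complex.ofReal_one, mul_one, Complex.ofReal_zero,
    mul_zero, Complex.exp_zero, h1, sub_self] at h
  exact (mul_eq_zero.1 h).resolve_left hc

theorem norm_inner_shift_one (p q : ℝ × ℝ) :
    ‖inner ℂ (shiftIsometry p.1 p.2 unitIntervalIndicator)
      (shiftIsometry q.1 q.2 unitIntervalIndicator)‖ =
    ‖inner ℂ unitIntervalIndicator
      (shiftIsometry (q - p).1 (q - p).2 unitIntervalIndicator)‖ :=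
  norm_inner_shift_shift p q _ _

/-! ### The orthonormal basis along `ℤ²`. -/

/-- The Gabor system of the unit interval along `ℤ²`. -/
noncomputable def unitGabor (z : ℤ × ℤ) : L2R := shiftIsometry z.1 z.2 unitIntervalIndicator

theorem orthonormal_unitGabor : Orthonormal ℂ unitGabor := by
  refine ⟨fun z => by rw [unitGabor, LinearIsometry.norm_map, norm_unitIntervalIndicator], ?_⟩
  intro z z' hz
  rw [unitGabor, unitGabor, ← norm_eq_zero, norm_inner_shift_one ((z.1 : ℝ), (z.2 : ℝ))
    ((z'.1 : ℝ), (z'.2 : ℝ)), norm_eq_zero]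
  simp only [Prod.mk_sub_mk]
  by_cases h : z'.1 - z.1 = 0
  · have h2 : z'.2 - z.2 ≠ 0 := fun h2 => hz (Prod.ext (by omega) (by omega))
    rw [← Int.cast_sub, h, Int.cast_zero, ← Int.cast_sub]
    exact ambiguity_int_eq_zero h2
  · refine ambiguity_eq_zero_of_one_le ?_ _
    rw [← Int.cast_sub, ← Int.cast_abs]
    exact_mod_cast Int.one_le_abs h

/-- For fixed m the inner products are the Fourier coefficients of f on [m, m + 1], and Parseval
makes f vanish there. -/
theorem eq_zero_of_inner_unitGabor {f : L2R} (h : ∀ z, inner ℂ (unitGabor z) f = 0) : f = 0 := by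
  have hm : ∀ m : ℤ, ∀ᵐ x ∂(volume.restrict (Set.Ioc (m : ℝ) (m + 1))), f x = 0 := by
    intro m
    have hab : (m : ℝ) < m + 1 := by linarith
    have hL : MemLp f 2 (volume.restrict (Set.Ioc (m : ℝ) (m + 1))) := (Lp.memLp f).restrict _
    have hs := hasSum_sq_fourierCoeffOn hab hL
    have hz : ∀ n : ℤ, fourierCoeffOn hab f n = 0 := by
      intro n
      rw [fourierCoeffOn_eq_integral, intervalIntegral.integral_of_le hab.le,
        ← integral_Icc_eq_integral_Ioc]
      have := h (m, n)
      rw [unitGabor, inner_shift_unitIntervalIndicator] at this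
      refine (congrArg _ (Eq.trans (integral_congr_ae
        (Filter.Eventually.of_forall fun x => ?_)) this)).trans (smul_zero _)
      simp only [fourier_coe_apply, smul_eq_mul]
      congr 2
      push_cast
      rw [add_sub_cancel_left]
      ring
    simp only [hz, norm_zero, ne_eq, OfNat.ofNat_ne_zero, not_false_eq_true, zero_pow] at hs
    have h0 := hs.unique hasSum_zero
    rw [add_sub_cancel_left, inv_one, one_smul, intervalIntegral.integral_of_le hab.le,
      integral_eq_zero_iff_of_nonneg (fun x => by positivity) hL.integrable_norm_pow'] at h0
    filter_upwards [h0] with x hx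
    simpa using hx
  apply Lp.ext
  have hall : ∀ᵐ x ∂(volume.restrict (⋃ m : ℤ, Set.Ioc (m : ℝ) (m + 1))), f x = 0 :=
    (ae_restrict_iUnion_iff _ _).2 hm
  rw [iUnion_Ioc_intCast, Measure.restrict_univ] at hall
  filter_upwards [hall, Lp.coeFn_zero ℂ 2 (volume : Measure ℝ)] with x hx hz
  rw [hz, hx, Pi.zero_apply]

/-! ### Transfer to the rotated lattice. -/

theorem planeRotation_planeRotation_neg (θ : ℝ) (p : ℝ × ℝ) :
    planeRotation θ (planeRotation (-θ) p) = p := by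
  simp only [planeRotation, Real.cos_neg, Real.sin_neg]
  ext
  · linear_combination p.1 * Real.sin_sq_add_cos_sq θ
  · linear_combination p.2 * Real.sin_sq_add_cos_sq θ

/-- The factor c compares the phases e^{πits} at p and at the rotated point. Being unimodular, it
affects neither orthonormality nor completeness. -/
theorem exists_shift_fractionalFourier_eq_smul (θ : ℝ) (p : ℝ × ℝ) :
    ∃ c : ℂ, ‖c‖ = 1 ∧
      shiftIsometry p.1 p.2 (fractionalFourier (-θ) unitIntervalIndicator) =
        c • fractionalFourierEquiv (-θ)
          (shiftIsometry (planeRotation (-θ) p).1 (planeRotation (-θ) p).2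
            unitIntervalIndicator) := by
  refine ⟨Complex.exp ((Real.pi * p.1 * p.2 : ℝ) * Complex.I) *
    Complex.exp (-((Real.pi * (planeRotation (-θ) p).1 * (planeRotation (-θ) p).2 : ℝ) *
      Complex.I)), ?_, ?_⟩
  · rw [norm_mul, Complex.exp_neg, norm_inv, Complex.norm_exp_ofReal_mul_I,
      Complex.norm_exp_ofReal_mul_I, inv_one, mul_one]
  · rw [shiftIsometry_eq_symShift (planeRotation (-θ) p), map_smul, fractionalFourierEquiv_symShift,
      planeRotation_planeRotation_neg, smul_smul, mul_assoc, ← Complex.exp_add, neg_add_cancel,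
      Complex.exp_zero, mul_one, shiftIsometry_eq_symShift, fractionalFourierEquiv_apply]

theorem norm_fractionalFourier_unitIntervalIndicator (θ : ℝ) :
    ‖fractionalFourier (-θ) unitIntervalIndicator‖ = 1 := by
  rw [← fractionalFourierEquiv_apply, LinearIsometryEquiv.norm_map, norm_unitIntervalIndicator]

theorem norm_inner_shift_fractionalFourier (θ : ℝ) (p q : ℝ × ℝ) :
    ‖inner ℂ (shiftIsometry p.1 p.2 (fractionalFourier (-θ) unitIntervalIndicator))
      (shiftIsometry q.1 q.2 (fractionalFourier (-θ) unitIntervalIndicator))‖ =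
    ‖inner ℂ unitIntervalIndicator (shiftIsometry (planeRotation (-θ) (q - p)).1
      (planeRotation (-θ) (q - p)).2 unitIntervalIndicator)‖ := by
  obtain ⟨c, hc, h⟩ := exists_shift_fractionalFourier_eq_smul θ (q - p)
  rw [norm_inner_shift_shift, h, ← fractionalFourierEquiv_apply, inner_smul_right, norm_mul, hc,
    one_mul, LinearIsometryEquiv.inner_map_map]

theorem isOrthonormalBasis_range {ι : Type*} {v : ι → L2R} (hv : Orthonormal ℂ v)
    (h : ∀ f, (∀ i, inner ℂ (v i) f = 0) → f = 0) : IsOrthonormalBasis (Set.range v) :=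
  ⟨hv.toSubtypeRange, (Submodule.topologicalClosure_eq_top_iff).2 (orthogonal_span_range_eq_bot h)⟩

theorem isOrthonormalBasis_gaborSystem_rotation (θ : ℝ) :
    IsOrthonormalBasis
      (gaborSystem (fractionalFourier (-θ) unitIntervalIndicator)
        (planeRotation θ '' integerLattice)) := by
  set g := fractionalFourier (-θ) unitIntervalIndicator with hg
  let v : ℤ × ℤ → L2R := fun z =>
    shiftIsometry (planeRotation θ (z.1, z.2)).1 (planeRotation θ (z.1, z.2)).2 g
  have hS : gaborSystem g (planeRotation θ '' integerLattice) = Set.range v := by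
    rw [gaborSystem, integerLattice, ← Set.range_comp, ← Set.range_comp]
    rfl
  have hv : ∀ z, ∃ c : ℂ, ‖c‖ = 1 ∧ v z = c • fractionalFourierEquiv (-θ) (unitGabor z) := by
    intro z
    have h := exists_shift_fractionalFourier_eq_smul θ (planeRotation θ ((z.1 : ℝ), (z.2 : ℝ)))
    have h2 := planeRotation_planeRotation_neg (-θ) ((z.1 : ℝ), (z.2 : ℝ))
    rw [neg_neg] at h2
    rw [h2] at h
    exact h
  choose c hc hv using hv
  rw [hS]
  refine isOrthonormalBasis_range ⟨fun z => ?_, fun z z' hz => ?_⟩ fun f hf => ?_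
  · rw [hv, norm_smul, hc, one_mul, LinearIsometryEquiv.norm_map, orthonormal_unitGabor.1]
  · change inner ℂ (v z) (v z') = 0
    rw [hv, hv, inner_smul_left, inner_smul_right, LinearIsometryEquiv.inner_map_map,
      orthonormal_unitGabor.2 hz, mul_zero, mul_zero]
  · have h0 : (fractionalFourierEquiv (-θ)).symm f = 0 := by
      refine eq_zero_of_inner_unitGabor fun z => ?_
      have h1 := hf z
      rw [hv, inner_smul_left] at h1
      have h2 : c z ≠ 0 := fun h => by simpa [h] using hc z
      have h3 := (mul_eq_zero.1 h1).resolve_left (by simpa using h2)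
      rw [← (fractionalFourierEquiv (-θ)).inner_map_map, LinearIsometryEquiv.apply_symm_apply, h3]
    simpa using h0

/-! ### Bessel, Parseval and the integral of the spectrogram. -/

theorem Orthonormal.tsum_enorm_inner_sq_le {ι : Type*} {v : ι → L2R} (hv : Orthonormal ℂ v)
    (f : L2R) : ∑' i, ‖inner ℂ (v i) f‖ₑ ^ 2 ≤ ‖f‖ₑ ^ 2 := by
  have h := hv.tsum_inner_products_le (x := f)
  have h2 := ENNReal.ofReal_le_ofReal h
  rw [ENNReal.ofReal_tsum_of_nonneg (fun _ => by positivity) (hv.inner_products_summable f),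
    ENNReal.ofReal_pow (norm_nonneg _), ofReal_norm] at h2
  simpa only [ENNReal.ofReal_pow (norm_nonneg _), ofReal_norm] using h2

theorem IsOrthonormalBasis.tsum_enorm_inner_sq {S : Set L2R} (hS : IsOrthonormalBasis S)
    (f : L2R) : ∑' e : S, ‖inner ℂ (e : L2R) f‖ₑ ^ 2 = ‖f‖ₑ ^ 2 := by
  let b : HilbertBasis S ℂ L2R := HilbertBasis.mk hS.1 (by rw [Subtype.range_coe, hS.2])
  have hb : ∀ e : S, b e = e := fun e => congrFun (HilbertBasis.coe_mk _ _) e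
  have h : HasSum (fun e : S => ‖inner ℂ (e : L2R) f‖ ^ 2) (‖f‖ ^ 2) := by
    have h1 := b.hasSum_inner_mul_inner f f
    rw [inner_self_eq_norm_sq_to_K] at h1
    rw [← Complex.hasSum_ofReal]
    push_cast
    refine h1.congr_fun fun e => ?_
    rw [← inner_conj_symm f (b e), RCLike.conj_mul, hb]
    rfl
  have h2 := congrArg ENNReal.ofReal h.tsum_eq
  rw [ENNReal.ofReal_tsum_of_nonneg (fun _ => by positivity) h.summable,
    ENNReal.ofReal_pow (norm_nonneg _), ofReal_norm] at h2
  simpa only [ENNReal.ofReal_pow (norm_nonneg _), ofReal_norm] using h2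

/-- The squared modulus of the ambiguity function of the unit interval. -/
noncomputable def unitSpectrogram (w : ℝ × ℝ) : ℝ≥0∞ :=
  ‖inner ℂ unitIntervalIndicator (shiftIsometry w.1 w.2 unitIntervalIndicator)‖ₑ ^ 2

theorem measurable_unitSpectrogram : Measurable unitSpectrogram := by
  let F : ℝ × ℝ → ℝ → ℂ := fun w x =>
    (Set.Icc (max 0 w.1) (min 1 (w.1 + 1))).indicator
      (fun x : ℝ => Complex.exp (2 * Real.pi * Complex.I * w.2 * x)) x
  have hF : Measurable (Function.uncurry F) := by
    have hs : MeasurableSet {y : (ℝ × ℝ) × ℝ | max 0 y.1.1 ≤ y.2 ∧ y.2 ≤ min 1 (y.1.1 + 1)} :=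
      measurableSet_setOfPred.2 ((measurableSet_setOfPred.1 (measurableSet_le
        (f := fun y : (ℝ × ℝ) × ℝ => max 0 y.1.1) (by fun_prop) (by fun_prop))).and
        (measurableSet_setOfPred.1 (measurableSet_le
          (g := fun y : (ℝ × ℝ) × ℝ => min 1 (y.1.1 + 1)) (by fun_prop) (by fun_prop))))
    have hm : Measurable fun y : (ℝ × ℝ) × ℝ =>
        Complex.exp (2 * Real.pi * Complex.I * y.1.2 * y.2) := by fun_prop
    exact hm.indicator hs
  have hi : Measurable fun w => ∫ x, F w x :=
    (hF.stronglyMeasurable.integral_prod_right).measurable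
  have he : unitSpectrogram = fun w => ‖∫ x, F w x‖ₑ ^ 2 := by
    funext w
    rw [unitSpectrogram, ambiguity_unitIntervalIndicator, ← integral_indicator measurableSet_Icc]
  rw [he]
  exact hi.enorm.pow_const 2

theorem setLIntegral_preimage_add_right {Q : Set (ℝ × ℝ)} (hQ : MeasurableSet Q)
    {F : ℝ × ℝ → ℝ≥0∞} (hF : Measurable F) (p : ℝ × ℝ) :
    ∫⁻ w in (fun w => w + p) ⁻¹' Q, F w = ∫⁻ z in Q, F (z - p) := by
  have h := (measurePreserving_add_right (volume : Measure (ℝ × ℝ)) p).setLIntegral_comp_preimage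
    hQ (f := fun z => F (z - p)) (by fun_prop)
  simpa using h

/-- Periodizing over `ℤ²` reduces the integral to the unit square. There the periodized sum is at
most 1 by Bessel's inequality for `unitGabor`. -/
theorem lintegral_unitSpectrogram_le : ∫⁻ w, unitSpectrogram w ≤ 1 := by
  let Q : Set (ℝ × ℝ) := Set.Ico 0 1 ×ˢ Set.Ico 0 1
  have hQ : MeasurableSet Q := measurableSet_Ico.prod measurableSet_Ico
  let ι : ℤ × ℤ → ℝ × ℝ := fun z => (-(z.1 : ℝ), -(z.2 : ℝ))
  have hcov : ⋃ z : ℤ × ℤ, (fun w => w + ι z) ⁻¹' Q = Set.univ := by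
    refine Set.eq_univ_of_forall fun w => Set.mem_iUnion.2 ⟨(⌊w.1⌋, ⌊w.2⌋), ?_⟩
    simp only [Q, ι, Set.mem_preimage, Set.mem_prod, Prod.fst_add, Prod.snd_add, Set.mem_Ico]
    refine ⟨⟨?_, ?_⟩, ?_, ?_⟩ <;>
    linarith [Int.floor_le w.1, Int.lt_floor_add_one w.1, Int.floor_le w.2,
      Int.lt_floor_add_one w.2]
  calc ∫⁻ w, unitSpectrogram w
      = ∫⁻ w in ⋃ z : ℤ × ℤ, (fun w => w + ι z) ⁻¹' Q, unitSpectrogram w := by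
        rw [hcov, Measure.restrict_univ]
    _ ≤ ∑' z : ℤ × ℤ, ∫⁻ w in (fun w => w + ι z) ⁻¹' Q, unitSpectrogram w :=
        lintegral_iUnion_le _ _
    _ = ∑' z : ℤ × ℤ, ∫⁻ w in Q, unitSpectrogram (w - ι z) := by
        simp_rw [setLIntegral_preimage_add_right hQ measurable_unitSpectrogram]
    _ = ∫⁻ w in Q, ∑' z : ℤ × ℤ, unitSpectrogram (w - ι z) :=
        (lintegral_tsum fun z => (measurable_unitSpectrogram.comp
          (measurable_id.sub_const _)).aemeasurable).symm
    _ ≤ ∫⁻ w in Q, 1 := by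
        -- The sum over z consists of the squared coefficients of the unit vector π(-w)1_[0,1] in
        -- the system `unitGabor`.
        refine lintegral_mono fun w => ?_
        have h := orthonormal_unitGabor.tsum_enorm_inner_sq_le
          (shiftIsometry (-w).1 (-w).2 unitIntervalIndicator)
        rw [← ofReal_norm, LinearIsometry.norm_map, norm_unitIntervalIndicator, ENNReal.ofReal_one,
          one_pow] at h
        refine le_trans (le_of_eq (tsum_congr fun z => ?_)) h
        have hz : ((z.1 : ℝ), (z.2 : ℝ)) - -w = w - ι z := by
          ext <;> simp [ι] <;> ring
        have hn := norm_inner_shift_one (-w) ((z.1 : ℝ), (z.2 : ℝ))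
        rw [hz] at hn
        rw [unitSpectrogram, unitGabor, ← ofReal_norm, ← ofReal_norm, ← hn, norm_inner_symm]
    _ = 1 := by
        rw [setLIntegral_one, Measure.volume_eq_prod, Measure.prod_prod]
        simp

theorem measurePreserving_planeRotation (θ : ℝ) :
    MeasurePreserving (planeRotation θ) volume volume := by
  let L : (ℝ × ℝ) →ₗ[ℝ] (ℝ × ℝ) := Matrix.toLin (Module.Basis.finTwoProd ℝ)
    (Module.Basis.finTwoProd ℝ) !![Real.cos θ, -Real.sin θ; Real.sin θ, Real.cos θ]
  have hL : ⇑L = planeRotation θ := by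
    funext p
    rw [Matrix.toLin_finTwoProd_apply, planeRotation]
    ext <;> simp
    ring
  have hdet : LinearMap.det L = 1 := by
    rw [LinearMap.det_toLin, Matrix.det_fin_two_of]
    linear_combination Real.sin_sq_add_cos_sq θ
  refine ⟨by rw [← hL]; exact L.continuous_of_finiteDimensional.measurable, ?_⟩
  rw [← hL, Measure.map_linearMap_addHaar_eq_smul_addHaar _ (by rw [hdet]; exact one_ne_zero), hdet]
  simp

/-! ### Separation of product sets and the density contradiction. -/

/-- Modulus 1 is excluded for 0 < |t| < 1 by the bound 1 - |t| on the overlap of the two intervals.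
-/
theorem one_le_abs_of_norm_ambiguity {t s : ℝ} (ht : t ≠ 0)
    (h : ‖inner ℂ unitIntervalIndicator (shiftIsometry t s unitIntervalIndicator)‖ = 0 ∨
      ‖inner ℂ unitIntervalIndicator (shiftIsometry t s unitIntervalIndicator)‖ = 1) :
    1 ≤ |t| ∨ 1 ≤ |s| := by
  rcases h with h | h
  · exact one_le_abs_of_ambiguity_eq_zero (norm_eq_zero.1 h)
  · left
    by_contra! hlt
    have := norm_ambiguity_le hlt.le s
    have := abs_pos.2 ht
    linarith

/-- If the Gabor system of a unit vector along `Λ` is an orthonormal basis, two of its shifts have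
inner product of modulus `0` or `1`. -/
theorem norm_inner_eq_zero_or_one {g : L2R} (hg : ‖g‖ = 1) {Λ : Set (ℝ × ℝ)}
    (h : IsOrthonormalBasis (gaborSystem g Λ)) {p q : ℝ × ℝ} (hp : p ∈ Λ) (hq : q ∈ Λ) :
    ‖inner ℂ (shiftIsometry p.1 p.2 g) (shiftIsometry q.1 q.2 g)‖ = 0 ∨
      ‖inner ℂ (shiftIsometry p.1 p.2 g) (shiftIsometry q.1 q.2 g)‖ = 1 := by
  -- The Gabor system is a set, so different points of Λ might give the same vector. This is the
  -- source of the value 1.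
  by_cases he : shiftIsometry p.1 p.2 g = shiftIsometry q.1 q.2 g
  · right
    rw [he, inner_self_eq_norm_sq_to_K, LinearIsometry.norm_map, hg]
    simp
  · left
    rw [norm_eq_zero]
    exact h.1.2 (i := ⟨_, ⟨p, hp, rfl⟩⟩) (j := ⟨_, ⟨q, hq, rfl⟩⟩) fun h => he (congrArg Subtype.val h)

theorem min_inv_le_of_one_le {c s u : ℝ} (hc : c ≠ 0) (hs : s ≠ 0)
    (h : 1 ≤ |c * u| ∨ 1 ≤ |s * u|) : min |c|⁻¹ |s|⁻¹ ≤ |u| := by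
  rcases h with h | h
  · refine (min_le_left _ _).trans ?_
    rwa [inv_le_iff_one_le_mul₀' (abs_pos.2 hc), ← abs_mul]
  · refine (min_le_right _ _).trans ?_
    rwa [inv_le_iff_one_le_mul₀' (abs_pos.2 hs), ← abs_mul]

theorem le_abs_sub_of_isOrthonormalBasis {θ : ℝ} (hc : Real.cos θ ≠ 0) (hs : Real.sin θ ≠ 0)
    {A B : Set ℝ} (h : IsOrthonormalBasis
      (gaborSystem (fractionalFourier (-θ) unitIntervalIndicator) (A ×ˢ B)))
    {p q : ℝ × ℝ} (hp : p ∈ A ×ˢ B) (hq : q ∈ A ×ˢ B) (hpq : p ≠ q) :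
    min |Real.cos θ|⁻¹ |Real.sin θ|⁻¹ ≤ |q.1 - p.1| ∨
      min |Real.cos θ|⁻¹ |Real.sin θ|⁻¹ ≤ |q.2 - p.2| := by
  by_cases h1 : p.1 = q.1
  · have h2 : q.2 - p.2 ≠ 0 := fun h2 => hpq (Prod.ext h1 (sub_eq_zero.1 h2).symm)
    have h3 := norm_inner_eq_zero_or_one (norm_fractionalFourier_unitIntervalIndicator θ) h hp hq
    rw [norm_inner_shift_fractionalFourier] at h3
    simp only [planeRotation, Prod.fst_sub, Prod.snd_sub, h1, sub_self, mul_zero, Real.cos_neg,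
      Real.sin_neg, zero_sub, zero_add, neg_mul, neg_neg] at h3
    right
    refine min_inv_le_of_one_le hc hs ?_
    exact (one_le_abs_of_norm_ambiguity (mul_ne_zero hs h2) h3).symm
  · have h2 : q.1 - p.1 ≠ 0 := fun h2 => h1 (sub_eq_zero.1 h2).symm
    -- The product structure enters here: the corner (q.1, p.2) lies in A × B and differs from p
    -- only in the first coordinate.
    have hq' : (q.1, p.2) ∈ A ×ˢ B := ⟨hq.1, hp.2⟩
    have h3 := norm_inner_eq_zero_or_one (norm_fractionalFourier_unitIntervalIndicator θ) h hp hq'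
    rw [norm_inner_shift_fractionalFourier] at h3
    simp only [planeRotation, Prod.fst_sub, Prod.snd_sub, sub_self, mul_zero, Real.cos_neg,
      Real.sin_neg, sub_zero, add_zero, neg_mul] at h3
    left
    refine min_inv_le_of_one_le hc hs ?_
    have h4 := one_le_abs_of_norm_ambiguity (mul_ne_zero hc h2) h3
    rwa [abs_neg] at h4

/-- If the Gabor system is an orthonormal basis along `Λ` and the points of `Λ` are separated in
the maximum norm by `d`, then `d ≤ 1`. -/
theorem le_one_of_isOrthonormalBasis {θ d : ℝ} (hd : 0 < d) {Λ : Set (ℝ × ℝ)}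
    (h : IsOrthonormalBasis (gaborSystem (fractionalFourier (-θ) unitIntervalIndicator) Λ))
    (hsep : ∀ p ∈ Λ, ∀ q ∈ Λ, p ≠ q → d ≤ |q.1 - p.1| ∨ d ≤ |q.2 - p.2|) : d ≤ 1 := by
  set g := fractionalFourier (-θ) unitIntervalIndicator with hg
  let Q : Set (ℝ × ℝ) := Set.Ico 0 d ×ˢ Set.Ico 0 d
  have hQ : MeasurableSet Q := measurableSet_Ico.prod measurableSet_Ico
  -- These are the translates Q - p, pairwise disjoint because the half-open square Q has side d.
  let C : ℝ × ℝ → Set (ℝ × ℝ) := fun p => (fun w => w + p) ⁻¹' Q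
  have hCm : ∀ p, MeasurableSet (C p) := fun p => (measurable_id.add_const p) hQ
  have hdisj : Λ.PairwiseDisjoint C := by
    intro p hp q hq hpq
    rw [Function.onFun, Set.disjoint_left]
    rintro w ⟨⟨h1, h2⟩, h3, h4⟩ ⟨⟨h5, h6⟩, h7, h8⟩
    simp only [Prod.fst_add, Prod.snd_add] at h1 h2 h3 h4 h5 h6 h7 h8
    rcases hsep p hp q hq hpq with h9 | h9 <;> rcases le_abs.1 h9 with h10 | h10 <;> linarith
  -- Countability is needed to exchange the sum over Λ with the integral.
  have hcount : Λ.Countable := by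
    refine hdisj.countable_of_nonempty_interior fun p _ => ⟨(d / 2, d / 2) - p, ?_⟩
    have ho : IsOpen ((fun w => w + p) ⁻¹' (Set.Ioo 0 d ×ˢ Set.Ioo 0 d)) :=
      (isOpen_Ioo.prod isOpen_Ioo).preimage (by fun_prop)
    refine interior_maximal (Set.preimage_mono
      (Set.prod_mono Set.Ioo_subset_Ico_self Set.Ioo_subset_Ico_self)) ho ?_
    simp only [Set.mem_preimage, sub_add_cancel, Set.mem_prod, Set.mem_Ioo]
    refine ⟨⟨?_, ?_⟩, ?_, ?_⟩ <;> linarith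
  have : Countable Λ := hcount
  let F : ℝ × ℝ → ℝ≥0∞ := fun w => unitSpectrogram (planeRotation (-θ) w)
  have hF : Measurable F :=
    measurable_unitSpectrogram.comp (measurePreserving_planeRotation (-θ)).measurable
  -- Parseval for the unit vector π(z)g. Only an inequality is claimed, since the sum over Λ may
  -- count a vector of the system more than once; `σ` picks one point for each vector.
  have hpt : ∀ z, 1 ≤ ∑' p : Λ, F (z - p) := by
    intro z
    have h1 := h.tsum_enorm_inner_sq (shiftIsometry z.1 z.2 g)
    rw [← ofReal_norm, LinearIsometry.norm_map, hg, norm_fractionalFourier_unitIntervalIndicator,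
      ENNReal.ofReal_one, one_pow] at h1
    have hsec : ∀ e : gaborSystem g Λ, ∃ p : Λ, shiftIsometry p.1.1 p.1.2 g = e := by
      rintro ⟨_, p, hp, rfl⟩
      exact ⟨⟨p, hp⟩, rfl⟩
    choose σ hσ using hsec
    have hinj : Function.Injective σ := fun e e' he => Subtype.ext (by rw [← hσ, ← hσ, he])
    rw [← h1]
    refine le_trans (le_of_eq (tsum_congr fun e => ?_))
      (ENNReal.tsum_comp_le_tsum_of_injective hinj fun p : Λ => F (z - p))
    simp only [F, unitSpectrogram]
    rw [← hσ e, ← ofReal_norm, ← ofReal_norm, norm_inner_shift_fractionalFourier]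
  have hle : ENNReal.ofReal d * ENNReal.ofReal d ≤ 1 := by
    calc ENNReal.ofReal d * ENNReal.ofReal d = ∫⁻ _ in Q, 1 := by
          rw [setLIntegral_one, Measure.volume_eq_prod, Measure.prod_prod]
          simp
      _ ≤ ∫⁻ z in Q, ∑' p : Λ, F (z - p) := lintegral_mono hpt
      _ = ∑' p : Λ, ∫⁻ z in Q, F (z - p) :=
          lintegral_tsum fun p => (hF.comp (measurable_id.sub_const _)).aemeasurable
      _ = ∑' p : Λ, ∫⁻ w in C p, F w := by
          simp_rw [C, setLIntegral_preimage_add_right hQ hF]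
      _ = ∫⁻ w in ⋃ p : Λ, C p, F w :=
          (lintegral_iUnion (fun p : Λ => hCm p)
            (fun p q hpq => hdisj p.2 q.2 fun h => hpq (Subtype.ext h)) _).symm
      _ ≤ ∫⁻ w, F w := setLIntegral_le_lintegral _ _
      _ = ∫⁻ w, unitSpectrogram w :=
          (measurePreserving_planeRotation (-θ)).lintegral_comp measurable_unitSpectrogram
      _ ≤ 1 := lintegral_unitSpectrogram_le
  rw [← ENNReal.ofReal_mul hd.le, ENNReal.ofReal_le_one] at hle
  nlinarith

theorem cos_ne_zero_and_sin_ne_zero {θ : ℝ} (hθ : ∀ k : ℤ, θ ≠ (Real.pi / 2) * k) :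
    Real.cos θ ≠ 0 ∧ Real.sin θ ≠ 0 := by
  constructor
  · intro h
    obtain ⟨k, hk⟩ := Real.cos_eq_zero_iff.1 h
    exact hθ (2 * k + 1) (by rw [hk]; push_cast; ring)
  · intro h
    obtain ⟨k, hk⟩ := Real.sin_eq_zero_iff.1 h
    exact hθ (2 * k) (by rw [← hk]; push_cast; ring)

theorem theorem1p3 (θ : ℝ) (hθ : ∀ k : ℤ, θ ≠ (Real.pi / 2) * k) :
    IsOrthonormalBasis
      (gaborSystem (fractionalFourier (-θ) unitIntervalIndicator)
        (planeRotation θ '' integerLattice)) ∧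
    ∀ A B : Set ℝ,
      ¬ IsOrthonormalBasis
        (gaborSystem (fractionalFourier (-θ) unitIntervalIndicator) (A ×ˢ B)) := by
  refine ⟨isOrthonormalBasis_gaborSystem_rotation θ, fun A B h => ?_⟩
  obtain ⟨hc, hs⟩ := cos_ne_zero_and_sin_ne_zero hθ
  have hsq := Real.sin_sq_add_cos_sq θ
  have hc0 := abs_pos.2 hc
  have hs0 := abs_pos.2 hs
  have hc1 : |Real.cos θ| < 1 := by
    rw [← sq_lt_one_iff_abs_lt_one]; nlinarith [sq_pos_of_ne_zero hs]
  have hs1 : |Real.sin θ| < 1 := by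
    rw [← sq_lt_one_iff_abs_lt_one]; nlinarith [sq_pos_of_ne_zero hc]
  -- Since θ is not a multiple of π/2, both |cos θ| and |sin θ| lie strictly between 0 and 1.
  have hd : 1 < min |Real.cos θ|⁻¹ |Real.sin θ|⁻¹ :=
    lt_min ((one_lt_inv₀ hc0).2 hc1) ((one_lt_inv₀ hs0).2 hs1)
  exact hd.not_ge (le_one_of_isOrthonormalBasis (zero_lt_one.trans hd) h
    fun p hp q hq hpq => le_abs_sub_of_isOrthonormalBasis hc hs h hp hq hpq)
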